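/- Let $G$ be a compact (Hausdorff) group with center $Z(G)$, and let $\mathcal{C}=\mathrm{Rep}\,G$ be the $\mathbb{C}$-linear symmetric tensor category of finite-dimensional continuous complex representations of $G$. For $X,Y\in\mathcal{C}$ write $X\prec Y$ if $X$ is isomorphic to a subobject of $Y$, and let $\overline{Y}$ denote the dual (contragredient) of $Y$. Let $\mathcal{C}_0\subset\mathcal{C}$ be the smallest full subcategory that is replete (closed under isomorphisms), monoidal (contains the unit object and is closed under tensor products), closed under finite direct sums, subobjects and duals, and contains every simple object $X$ for which there exists a simple object $Y\in\mathcal{C}$ with $X\prec Y\otimes\overline{Y}$. Let $\mathcal{C}_Z\subset\mathcal{C}$ be the full subcategory of those representations whose restriction to $Z(G)$ is trivial. Then $\mathcal{C}_0=\mathcal{C}_Z$. Consequently $\mathcal{C}_0\simeq\mathrm{Rep}(G/Z(G))$: the inflation functor $\mathrm{Rep}(G/Z(G))\to\mathrm{Rep}\,G$, which composes a representation with the quotient map $G\to G/Z(G)$, is, up to natural isomorphism, the composite of a $\mathbb{C}$-linear symmetric tensor equivalence $\mathrm{Rep}(G/Z(G))\to\mathcal{C}_0$ with the inclusion $\mathcal{C}_0\subset\mathrm{Rep}\,G$.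 -/

import Mathlib

open CategoryTheory MonoidalCategory

universe u v

noncomputable section

namespace RepCenter

/-! ### Tensor subcategories generated by objects -/

section General

variable {C : Type u} [Category.{v} C] [MonoidalCategory C] [Preadditive C]

/-- Fusion subcategories of `C`, as properties of objects: the full subcategories that are replete,
monoidal and closed under finite direct sums (which are the finite products, as `C` is additive),
subobjects and two-sided duals. -/
structure IsFusionSubcategory [RigidCategory C] (P : ObjectProperty C) : Prop where
  replete : P.IsClosedUnderIsomorphisms
  monoidal : P.IsMonoidal
  directSums : P.IsClosedUnderFiniteProducts
  subobjects : P.IsClosedUnderSubobjects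
  rightDuals : ∀ X : C, P X → P Xᘁ
  leftDuals : ∀ X : C, P X → P (ᘁX)

/-- The smallest fusion subcategory of `C` that contains the objects satisfying `S`. -/
def generatedFusionSubcategory [RigidCategory C] (S : ObjectProperty C) : ObjectProperty C :=
  sInf {P | IsFusionSubcategory P ∧ S ≤ P}

/-- The relation `X ≺ Y`: `X` is (isomorphic to) a subobject of `Y`. -/
def Contained (X Y : C) : Prop := ∃ i : X ⟶ Y, Mono i

variable (C) in
/-- The simple objects `X` such that `X ≺ Y ⊗ Yᘁ` for some simple object `Y`, with dual `Yᘁ`. -/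
def adjointGenerators [RigidCategory C] : ObjectProperty C :=
  fun X => Simple X ∧ ∃ Y : C, Simple Y ∧ Contained X (Y ⊗ Yᘁ)

variable (C) in
/-- The subcategory `C₀`. -/
def adjointSubcategory [RigidCategory C] : ObjectProperty C :=
  generatedFusionSubcategory (adjointGenerators C)

instance [RigidCategory C] (S : ObjectProperty C) :
    (generatedFusionSubcategory S).IsMonoidal where
  prop_unit := by
    simp only [generatedFusionSubcategory, sInf_apply, iInf_Prop_eq]
    rintro ⟨P, hP, -⟩
    exact hP.monoidal.prop_unit
  prop_tensor X Y hX hY := by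
    simp only [generatedFusionSubcategory, sInf_apply, iInf_Prop_eq] at hX hY ⊢
    rintro ⟨P, hP, hS⟩
    exact hP.monoidal.prop_tensor _ _ (hX ⟨P, hP, hS⟩) (hY ⟨P, hP, hS⟩)

instance [RigidCategory C] : (adjointSubcategory C).IsMonoidal :=
  inferInstanceAs (generatedFusionSubcategory (adjointGenerators C)).IsMonoidal

end General

/-! ### Finite-dimensional continuous representations -/

section Rep

/-- A finite-dimensional complex representation of `G` is continuous iff all its matrix
coefficients `g ↦ f (g v)` are continuous. -/
def continuousReps (G : Type u) [Monoid G] [TopologicalSpace G] : ObjectProperty (FDRep ℂ G) :=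
  fun V => ∀ (v : V) (f : Module.Dual ℂ V), Continuous fun g : G => f (V.ρ g v)

variable (G : Type u) [Group G] [TopologicalSpace G]

lemma tensor_ρ_tmul {G : Type u} [Monoid G] (X Y : FDRep ℂ G) (g : G) (x : X) (y : Y) :
    (X ⊗ Y : FDRep ℂ G).ρ g (x ⊗ₜ[ℂ] y : TensorProduct ℂ X Y) =
      (X.ρ g x ⊗ₜ[ℂ] Y.ρ g y : TensorProduct ℂ X Y) := rfl

instance : (continuousReps G).IsMonoidal where
  prop_unit := by
    intro v f
    exact continuous_const (y := f v)
  prop_tensor X Y hX hY := by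
    intro t f
    let f' : TensorProduct ℂ X Y →ₗ[ℂ] ℂ := f
    change Continuous fun g : G => f' ((X ⊗ Y : FDRep ℂ G).ρ g t)
    let t' : TensorProduct ℂ X Y := t
    change Continuous fun g : G => f' ((X ⊗ Y : FDRep ℂ G).ρ g t')
    induction t' using TensorProduct.induction_on with
    | zero =>
      have : ∀ g : G, (X ⊗ Y : FDRep ℂ G).ρ g (0 : TensorProduct ℂ X Y) =
        (0 : TensorProduct ℂ X Y) := fun g => map_zero _
      simp only [this]
      exact continuous_const
    | add a b ha hb =>
      have : ∀ g : G, (X ⊗ Y : FDRep ℂ G).ρ g (a + b : TensorProduct ℂ X Y) =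
        ((X ⊗ Y : FDRep ℂ G).ρ g a + (X ⊗ Y : FDRep ℂ G).ρ g b : TensorProduct ℂ X Y) :=
        fun g => map_add _ _ _
      simp only [this]
      have h2 : ∀ g : G, f' ((X ⊗ Y : FDRep ℂ G).ρ g a + (X ⊗ Y : FDRep ℂ G).ρ g b :
        TensorProduct ℂ X Y) = f' ((X ⊗ Y : FDRep ℂ G).ρ g a) + f' ((X ⊗ Y : FDRep ℂ G).ρ g b) :=
        fun g => map_add _ _ _
      simp only [h2]
      exact ha.add hb
    | tmul x y =>
      simp only [tensor_ρ_tmul]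
      let b := Module.finBasis ℂ X
      let c := Module.finBasis ℂ Y
      have key : ∀ g : G, f' (X.ρ g x ⊗ₜ[ℂ] Y.ρ g y) =
          ∑ i, ∑ j, b.coord i (X.ρ g x) * c.coord j (Y.ρ g y) * f' (b i ⊗ₜ[ℂ] c j) := by
        intro g
        conv_lhs => rw [← b.sum_repr (X.ρ g x), ← c.sum_repr (Y.ρ g y)]
        simp only [TensorProduct.sum_tmul, TensorProduct.tmul_sum, map_sum,
          ← TensorProduct.smul_tmul', TensorProduct.tmul_smul, map_smul, smul_eq_mul,
          Module.Basis.coord_apply]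
        rw [Finset.sum_comm]
        refine Finset.sum_congr rfl fun i _ => ?_
        rw [Finset.mul_sum]
        refine Finset.sum_congr rfl fun j _ => ?_
        ring
      simp only [key]
      exact continuous_finsetSum _ fun i _ => continuous_finsetSum _ fun j _ =>
        ((hX x _).mul (hY y _)).mul continuous_const

/-- `Rep G`: finite-dimensional continuous complex representations of `G`, with intertwiners. -/
abbrev RepCat : Type _ := (continuousReps G).FullSubcategory


/-- The subcategory `C_Z`: the representations that are trivial on the center of `G`. -/
def trivialOnCenter : ObjectProperty (RepCat G) :=
  fun X => ∀ z ∈ Subgroup.center G, X.obj.ρ z = 1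

lemma rightAdjointMate_apply {V W : FGModuleCat ℂ} (f : V ⟶ W) (φ : Module.Dual ℂ W) (x : V) :
    DFunLike.coe (F := Module.Dual ℂ V) ((fᘁ).hom.hom φ) x = φ (f.hom.hom x) := by
  have h := rightAdjointMate_comp_evaluation f
  have h2 := congrArg (fun k => k.hom.hom (φ ⊗ₜ[ℂ] x : TensorProduct ℂ (Module.Dual ℂ W) V)) h
  exact h2

/-- The dual representation is the contragredient one. -/
lemma dual_ρ_apply {G : Type u} [Group G] (X : FDRep ℂ G) (g : G) (φ : Module.Dual ℂ X) (x : X) :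
    DFunLike.coe (F := Module.Dual ℂ X) ((Xᘁ : FDRep ℂ G).ρ g φ) x = φ (X.ρ g⁻¹ x) := by
  rw [← FDRep.hom_hom_action_ρ, Action.rightDual_ρ]
  exact rightAdjointMate_apply _ _ _

variable [IsTopologicalGroup G]

lemma continuousReps_rightDual (X : FDRep ℂ G) (hX : continuousReps G X) :
    continuousReps G Xᘁ := by
  intro φ f
  let f' : Module.Dual ℂ (Module.Dual ℂ X) := f
  obtain ⟨x, hx⟩ := (Module.evalEquiv ℂ X).surjective f'
  have : ∀ g : G, f ((Xᘁ : FDRep ℂ G).ρ g φ) = DFunLike.coe (F := Module.Dual ℂ X) φ (X.ρ g⁻¹ x) := by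
    intro g
    refine Eq.trans ?_ (dual_ρ_apply X g φ x)
    exact (congrArg (fun k : Module.Dual ℂ (Module.Dual ℂ X) =>
      k ((Xᘁ : FDRep ℂ G).ρ g φ)) hx).symm
  simp only [this]
  exact (hX x φ).comp continuous_inv

variable {G} in
/-- The contragredient of a continuous representation. -/
def dualRep (X : RepCat G) : RepCat G := ⟨X.objᘁ, continuousReps_rightDual G _ X.property⟩

instance (X : RepCat G) : ExactPairing X (dualRep X) where
  coevaluation' := ObjectProperty.homMk (η_ X.obj X.objᘁ)
  evaluation' := ObjectProperty.homMk (ε_ X.obj X.objᘁ)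
  coevaluation_evaluation' := by
    ext1
    exact ExactPairing.coevaluation_evaluation X.obj X.objᘁ
  evaluation_coevaluation' := by
    ext1
    exact ExactPairing.evaluation_coevaluation X.obj X.objᘁ

instance : RightRigidCategory (RepCat G) where
  rightDual X := ⟨dualRep X⟩

/-- As `Rep G` is symmetric, the contragredient is both a left and a right dual. -/
instance : RigidCategory (RepCat G) := BraidedCategory.rigidCategoryOfRightRigidCategory

end Rep

/-- The inflation functor `Rep (G/N) ⥤ Rep G` composing representations with `G → G/N`. -/
def inflation (G : Type u) [Group G] [TopologicalSpace G] (N : Subgroup G) [N.Normal] :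
    RepCat (G ⧸ N) ⥤ RepCat G :=
  (continuousReps G).lift ((continuousReps (G ⧸ N)).ι ⋙ Action.res _ (QuotientGroup.mk' N))
    fun X v f => (X.property v f).comp continuous_quot_mk

end RepCenter

end

/-! One inclusion is Schur's lemma: a central element acts on a simple `Y` by a scalar, hence
trivially on `Y ⊗ Yᘁ`, and triviality on the centre survives all the closure operations.

For the converse, let `n` act trivially on `C₀`. If `Y` is simple, then `n` is trivial on every
simple subobject of `Y ⊗ Yᘁ`, so on `Y ⊗ Yᘁ` by complete reducibility, which forces `n` to be a
scalar on `Y`. Commutators with `n` are therefore trivial on all simple objects; as these separate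
the points of `G` (Peter–Weyl), `n` is central (`mem_center_of_adjointSubcategory`).

It remains to recover a fusion subcategory `P` from its common kernel `N`
(`prop_of_forall_ρ_eq_one`). The closure properties make the matrix coefficients of `P` a
point-separating star subalgebra of `C(G ⧸ N, ℂ)`, dense by Stone–Weierstrass. If every intertwiner
from `X` to `P` killed a vector `k`, averaging rank one maps would show that each coefficient `g ↦ f
(g⁻¹ k)` integrates to zero against this algebra, so vanishes, and `k = 0`. Hence morphisms to `P`
separate the points of `X`, and a direct sum of finitely many embeds `X` in an object of `P`.

Peter–Weyl itself comes from the spectral theorem for compact self-adjoint operators on `L²(G)` that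
commute with translations: their nonzero eigenspaces are finite-dimensional representations. -/

noncomputable section

namespace RepCenter

/-! ### Peter–Weyl: compact operators on `L²(G)` -/

section PeterWeyl

set_option linter.unusedSectionVars false

open MeasureTheory Measure Filter Topology
open scoped ENNReal InnerProductSpace BoundedContinuousFunction

variable {G : Type u} [Group G] [TopologicalSpace G] [IsTopologicalGroup G] [CompactSpace G]
  [T2Space G] [MeasurableSpace G] [BorelSpace G] (μ : Measure G) [μ.IsMulLeftInvariant] [μ.IsOpenPosMeasure]
  [μ.Regular]

/-- Left translation `φ ↦ φ (g⁻¹ ·)` on `L²(G)`. -/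
def leftTranslation : Representation ℂ G (Lp ℂ 2 μ) where
  toFun g :=
    { toFun := fun φ => DomMulAct.mk g⁻¹ • φ
      map_add' := fun φ ψ => DomMulAct.smul_Lp_add _ φ ψ
      map_smul' := fun c φ => smul_comm _ c φ }
  map_one' := by ext1 φ; simp
  map_mul' g h := by
    ext1 φ
    simp [mul_inv_rev, DomMulAct.mk_mul, mul_smul]

lemma leftTranslation_apply (g : G) (φ : Lp ℂ 2 μ) :
    leftTranslation μ g φ = DomMulAct.mk g⁻¹ • φ := rfl

lemma leftTranslation_toLp (g : G) (f : C(G, ℂ)) :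
    leftTranslation μ g (f.toLp 2 μ ℂ) =
      (f.comp ⟨fun x => g⁻¹ * x, continuous_const_mul _⟩ : C(G, ℂ)).toLp 2 μ ℂ := rfl

lemma norm_leftTranslation (g : G) (φ : Lp ℂ 2 μ) : ‖leftTranslation μ g φ‖ = ‖φ‖ :=
  DomMulAct.norm_smul_Lp _ _

lemma inner_leftTranslation (g : G) (φ ψ : Lp ℂ 2 μ) :
    ⟪leftTranslation μ g φ, leftTranslation μ g ψ⟫_ℂ = ⟪φ, ψ⟫_ℂ :=
  LinearIsometry.inner_map_map
    (⟨leftTranslation μ g, norm_leftTranslation μ g⟩ : Lp ℂ 2 μ →ₗᵢ[ℂ] Lp ℂ 2 μ) φ ψ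

lemma continuous_leftTranslation (φ : Lp ℂ 2 μ) : Continuous fun g => leftTranslation μ g φ := by
  have : Fact ((2 : ℝ≥0∞) ≠ ∞) := ⟨by simp⟩
  simp only [leftTranslation_apply]
  exact (DomMulAct.continuous_mk.comp continuous_inv).smul continuous_const

/-- The operator `φ ↦ (x ↦ ⟪L_x F, φ⟫)`, with values in continuous functions. -/
def correlation (F : Lp ℂ 2 μ) : Lp ℂ 2 μ →L[ℂ] (G →ᵇ ℂ) :=
  LinearMap.mkContinuous
    { toFun := fun φ => BoundedContinuousFunction.mkOfCompact
        ⟨fun x => ⟪leftTranslation μ x F, φ⟫_ℂ,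
          (continuous_leftTranslation μ F).inner continuous_const⟩
      map_add' := fun φ ψ => by
        ext x
        exact inner_add_right (𝕜 := ℂ) (leftTranslation μ x F) φ ψ
      map_smul' := fun c φ => by
        ext x
        exact inner_smul_right (𝕜 := ℂ) (leftTranslation μ x F) φ c } ‖F‖ (by
    intro φ
    refine (BoundedContinuousFunction.norm_le (by positivity)).2 fun x => ?_
    exact (norm_inner_le_norm (𝕜 := ℂ) (leftTranslation μ x F) φ).trans_eq (by
      rw [norm_leftTranslation μ x F]))

lemma correlation_apply (F φ : Lp ℂ 2 μ) (x : G) :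
    correlation μ F φ x = ⟪leftTranslation μ x F, φ⟫_ℂ := rfl

/-- Translations are unitary, so the translation of `φ` can be moved onto `F`. This equivariance
makes the eigenspaces of `correlationOp` invariant. -/
lemma correlation_leftTranslation (F φ : Lp ℂ 2 μ) (g x : G) :
    correlation μ F (leftTranslation μ g φ) x = correlation μ F φ (g⁻¹ * x) := by
  rw [correlation_apply, correlation_apply, ← inner_leftTranslation μ g _ φ, ← Module.End.mul_apply,
    ← map_mul, mul_inv_cancel_left]

/-- Arzelà–Ascoli: by Cauchy–Schwarz the image of the unit ball is bounded by `‖F‖`, and its values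
at `x` and `y` differ by at most `‖L_x F - L_y F‖`, which is small because translation is continuous
in `L²`. -/
lemma isCompactOperator_correlation (F : Lp ℂ 2 μ) : IsCompactOperator (correlation μ F) := by
  refine (isCompactOperator_iff_isCompact_closure_image_closedBall
    (correlation μ F : Lp ℂ 2 μ →ₗ[ℂ] (G →ᵇ ℂ)) one_pos).2 ?_
  refine BoundedContinuousFunction.arzela_ascoli (Metric.closedBall 0 ‖F‖)
    (isCompact_closedBall _ _) _ ?_ ?_
  · rintro _ x ⟨φ, hφ, rfl⟩
    rw [mem_closedBall_zero_iff] at hφ ⊢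
    refine (norm_inner_le_norm (𝕜 := ℂ) (leftTranslation μ x F) φ).trans ?_
    rw [norm_leftTranslation]
    exact mul_le_of_le_one_right (norm_nonneg _) hφ
  · intro x
    rw [Metric.equicontinuousAt_iff_right]
    intro ε hε
    have := (Metric.tendsto_nhds.1 ((continuous_leftTranslation μ F).tendsto x)) ε hε
    filter_upwards [this] with y hy
    rintro ⟨_, φ, hφ, rfl⟩
    rw [mem_closedBall_zero_iff] at hφ
    change dist ⟪leftTranslation μ x F, φ⟫_ℂ ⟪leftTranslation μ y F, φ⟫_ℂ < ε
    rw [dist_comm, dist_eq_norm, ← inner_sub_left]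
    refine (norm_inner_le_norm (𝕜 := ℂ) _ _).trans_lt ?_
    rw [dist_eq_norm] at hy
    exact (mul_le_of_le_one_right (norm_nonneg _) hφ).trans_lt hy

/-- The operator `φ ↦ (x ↦ ⟪L_x F, φ⟫)` on `L²(G)`. -/
def correlationOp (F : Lp ℂ 2 μ) : Lp ℂ 2 μ →L[ℂ] Lp ℂ 2 μ :=
  (BoundedContinuousFunction.toLp 2 μ ℂ).comp (correlation μ F)

lemma isCompactOperator_correlationOp (F : Lp ℂ 2 μ) : IsCompactOperator (correlationOp μ F) :=
  (isCompactOperator_correlation μ F).clm_comp (BoundedContinuousFunction.toLp 2 μ ℂ)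

lemma correlationOp_leftTranslation (F φ : Lp ℂ 2 μ) (g : G) :
    correlationOp μ F (leftTranslation μ g φ) = leftTranslation μ g (correlationOp μ F φ) := by
  have h : correlationOp μ F φ = (correlation μ F φ).toContinuousMap.toLp 2 μ ℂ := rfl
  rw [h, leftTranslation_toLp]
  change (correlation μ F (leftTranslation μ g φ)).toContinuousMap.toLp 2 μ ℂ = _
  congr 1
  ext x
  exact correlation_leftTranslation μ F φ g x

lemma isSymmetric_correlationOp (f : C(G, ℂ)) (hf : ∀ x, star (f x⁻¹) = f x) :
    (correlationOp μ (f.toLp 2 μ ℂ)).IsSymmetric := by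
  have hdense := ContinuousMap.toLp_denseRange ℂ μ ℂ (p := 2) (by simp)
  set T := correlationOp μ (f.toLp 2 μ ℂ) with hT
  intro φ ψ
  change ⟪T φ, ψ⟫_ℂ = ⟪φ, T ψ⟫_ℂ
  have hT' : ∀ a : C(G, ℂ), T (a.toLp 2 μ ℂ) =
    (correlation μ (f.toLp 2 μ ℂ) (a.toLp 2 μ ℂ)).toContinuousMap.toLp 2 μ ℂ := fun a => rfl
  have hc : ∀ (a : C(G, ℂ)) x, correlation μ (f.toLp 2 μ ℂ) (a.toLp 2 μ ℂ) x =
      ∫ y, f (y⁻¹ * x) * a y ∂μ := by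
    intro a x
    rw [correlation_apply, leftTranslation_toLp, ContinuousMap.inner_toLp]
    refine integral_congr_ae (ae_of_all _ fun y => ?_)
    have : star (f (x⁻¹ * y)) = f (y⁻¹ * x) := by
      rw [← hf (y⁻¹ * x), mul_inv_rev, inv_inv]
    change a y * star (f (x⁻¹ * y)) = _
    rw [this, mul_comm]
  -- On the dense subspace of continuous functions the operator has kernel `f (y⁻¹ * x)`, which is
  -- Hermitian by `hf`; Fubini then gives the symmetry.
  refine hdense.induction_on₂ (p := fun φ ψ => ⟪T φ, ψ⟫_ℂ = ⟪φ, T ψ⟫_ℂ) ?_ ?_ φ ψ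
  · exact isClosed_eq ((T.continuous.comp continuous_fst).inner continuous_snd)
      (continuous_fst.inner (T.continuous.comp continuous_snd))
  · intro a b
    rw [hT', hT', ContinuousMap.inner_toLp, ContinuousMap.inner_toLp]
    have h1 : ∀ x, b x * (starRingEnd ℂ)
        ((correlation μ (f.toLp 2 μ ℂ) (a.toLp 2 μ ℂ)).toContinuousMap x) =
        ∫ y, f (x⁻¹ * y) * b x * star (a y) ∂μ := by
      intro x
      change b x * (starRingEnd ℂ) (correlation μ (f.toLp 2 μ ℂ) (a.toLp 2 μ ℂ) x) = _
      rw [hc, ← integral_conj, ← integral_const_mul]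
      refine integral_congr_ae (ae_of_all _ fun y => ?_)
      have : star (f (y⁻¹ * x)) = f (x⁻¹ * y) := by
        rw [← hf (x⁻¹ * y), mul_inv_rev, inv_inv]
      change b x * star (f (y⁻¹ * x) * a y) = _
      rw [star_mul', this]
      ring
    have h2 : ∀ y, (correlation μ (f.toLp 2 μ ℂ) (b.toLp 2 μ ℂ)).toContinuousMap y *
        (starRingEnd ℂ) (a y) = ∫ x, f (x⁻¹ * y) * b x * star (a y) ∂μ := by
      intro y
      change correlation μ (f.toLp 2 μ ℂ) (b.toLp 2 μ ℂ) y * star (a y) = _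
      rw [hc, ← integral_mul_const]
    simp only [h1, h2]
    refine integral_integral_swap_of_hasCompactSupport ?_ (HasCompactSupport.of_compactSpace _)
    have := a.continuous
    have := b.continuous
    have := f.continuous
    fun_prop

/-- The eigenspaces of a compact self-adjoint operator span a dense subspace. Eigenvectors with
nonzero eigenvalue are fixed by `g`, and the kernel contributes nothing to the image of the
operator. -/
lemma leftTranslation_correlationOp_eq (F : Lp ℂ 2 μ) (hF : (correlationOp μ F).IsSymmetric) (g : G)
    (hg : ∀ c : ℂ, c ≠ 0 → ∀ φ, correlationOp μ F φ = c • φ → leftTranslation μ g φ = φ)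
    (φ : Lp ℂ 2 μ) : leftTranslation μ g (correlationOp μ F φ) = correlationOp μ F φ := by
  set T := correlationOp μ F with hT
  let U : Lp ℂ 2 μ →ₗᵢ[ℂ] Lp ℂ 2 μ := ⟨leftTranslation μ g, norm_leftTranslation μ g⟩
  have hU : ∀ ψ, leftTranslation μ g ψ = U ψ := fun _ => rfl
  simp only [hU] at hg ⊢
  let S : Submodule ℂ (Lp ℂ 2 μ) :=
    LinearMap.ker ((U.toLinearMap - LinearMap.id) ∘ₗ (T : Lp ℂ 2 μ →ₗ[ℂ] Lp ℂ 2 μ))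
  have hS : ∀ ψ, ψ ∈ S ↔ U (T ψ) = T ψ := fun ψ => by
    simp [S, sub_eq_zero]
  have hclosed : IsClosed (S : Set (Lp ℂ 2 μ)) := by
    have : (S : Set (Lp ℂ 2 μ)) = {ψ | U (T ψ) = T ψ} := Set.ext hS
    rw [this]
    exact isClosed_eq (U.continuous.comp T.continuous) T.continuous
  have hle : (⨆ c, Module.End.eigenspace (T : Module.End ℂ (Lp ℂ 2 μ)) c) ≤ S := by
    refine iSup_le fun c ψ hψ => ?_
    rw [Module.End.mem_eigenspace_iff] at hψ
    replace hψ : T ψ = c • ψ := hψ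
    rw [hS, hψ]
    rcases eq_or_ne c 0 with rfl | hc
    · simp
    · rw [map_smul, hg c hc ψ hψ]
  have hbot := ContinuousLinearMap.orthogonalComplement_iSup_eigenspaces_eq_bot
    (isCompactOperator_correlationOp μ F) hF
  rw [← Submodule.topologicalClosure_eq_top_iff] at hbot
  exact (hS φ).1 (Submodule.topologicalClosure_minimal _ hle hclosed
    (hbot ▸ Submodule.mem_top))

/-- The action of `G` on the eigenspace of a correlation operator. -/
def eigenspaceRep (F : Lp ℂ 2 μ) (c : ℂ) :
    Representation ℂ G (Module.End.eigenspace (correlationOp μ F : Module.End ℂ (Lp ℂ 2 μ)) c) where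
  toFun g := (leftTranslation μ g).restrict fun φ hφ => by
    rw [Module.End.mem_eigenspace_iff] at hφ ⊢
    change correlationOp μ F φ = _ at hφ
    change correlationOp μ F _ = _
    rw [correlationOp_leftTranslation, hφ, map_smul]
  map_one' := by ext; simp
  map_mul' g h := by ext; simp

lemma exists_symmetric_continuousMap_ne (g : G) (hg : g ≠ 1) :
    ∃ f : C(G, ℂ), (∀ x, star (f x⁻¹) = f x) ∧ f g ≠ f 1 := by
  obtain ⟨u, hu0, hu1, -⟩ := exists_continuous_zero_one_of_isClosed (X := G)
    (isClosed_singleton (x := 1)) (isClosed_singleton (x := g)) (by simpa using hg.symm)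
  have hu0' : u 1 = 0 := hu0 rfl
  have hu1' : u g = 1 := hu1 rfl
  -- Symmetrizing a Urysohn function under inversion gives the symmetry; the squares prevent
  -- cancellation, so the value at `g` is at least `1`, while that at `1` is `0`.
  refine ⟨⟨fun x => ((u x ^ 2 + u x⁻¹ ^ 2 : ℝ) : ℂ), by have := u.continuous; fun_prop⟩, ?_, ?_⟩
  · intro x
    change star ((u x⁻¹ ^ 2 + u x⁻¹⁻¹ ^ 2 : ℝ) : ℂ) = ((u x ^ 2 + u x⁻¹ ^ 2 : ℝ) : ℂ)
    rw [inv_inv, add_comm]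
    exact Complex.conj_ofReal _
  · change ((u g ^ 2 + u g⁻¹ ^ 2 : ℝ) : ℂ) ≠ ((u 1 ^ 2 + u 1⁻¹ ^ 2 : ℝ) : ℂ)
    rw [inv_one, hu0', hu1', Ne, Complex.ofReal_inj]
    have := sq_nonneg (u g⁻¹)
    intro h
    linarith

end PeterWeyl

/-- **Peter–Weyl**: finite-dimensional continuous representations separate the points of a compact
Hausdorff group. -/
theorem exists_representation_ne_one {G : Type u} [Group G] [TopologicalSpace G]
    [IsTopologicalGroup G] [CompactSpace G] [T2Space G] (g : G) (hg : g ≠ 1) :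
    ∃ (n : ℕ) (ρ : Representation ℂ G (Fin n → ℂ)),
      (∀ v (f : Module.Dual ℂ (Fin n → ℂ)), Continuous fun x => f (ρ x v)) ∧ ρ g ≠ 1 := by
  by_contra! H
  borelize G
  let μ : MeasureTheory.Measure G := MeasureTheory.Measure.haar
  obtain ⟨f, hf, hfg⟩ := exists_symmetric_continuousMap_ne g hg
  let F := f.toLp 2 μ ℂ
  have key := leftTranslation_correlationOp_eq μ F (isSymmetric_correlationOp μ f hf) g (by
    intro c hc φ hφ
    let E := Module.End.eigenspace
      (correlationOp μ F : Module.End ℂ (MeasureTheory.Lp ℂ 2 μ)) c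
    have : FiniteDimensional ℂ E := ContinuousLinearMap.finite_dimensional_eigenspace
      (isCompactOperator_correlationOp μ F) c hc
    let e : E ≃ₗ[ℂ] (Fin (Module.finrank ℂ E) → ℂ) := (Module.finBasis ℂ E).equivFun
    have := H (Module.finrank ℂ E) ((e.conjRingEquiv : _ →* _).comp (eigenspaceRep μ F c)) (by
      intro v l
      have h1 : Continuous (l ∘ₗ e.toLinearMap) := LinearMap.continuous_of_finiteDimensional _
      refine h1.comp (g := l ∘ₗ e.toLinearMap)
        (f := fun x => eigenspaceRep μ F c x (e.symm v)) ?_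
      exact Continuous.subtype_mk (continuous_leftTranslation μ _) _)
    have h2 : eigenspaceRep μ F c g = 1 := (map_eq_one_iff _ e.conjRingEquiv.injective).1 this
    exact congrArg Subtype.val (DFunLike.congr_fun h2
      (⟨φ, Module.End.mem_eigenspace_iff.2 hφ⟩ : E)))
  -- Both sides of `key` are classes of continuous functions, which agree everywhere because the
  -- measure is positive on open sets; they are compared at the point `1`.
  have h3 : ∀ φ, inner ℂ (leftTranslation μ g⁻¹ F) φ = inner ℂ F φ := by
    intro φ
    have h4 := key φ
    rw [← correlationOp_leftTranslation] at h4
    have h5 := BoundedContinuousFunction.toLp_injective (𝕜 := ℂ) (p := 2) μ h4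
    have h6 : correlation μ F _ 1 = correlation μ F _ 1 := DFunLike.congr_fun h5 1
    rw [correlation_leftTranslation, mul_one, correlation_apply, correlation_apply, map_one] at h6
    exact h6
  have h7 : leftTranslation μ g⁻¹ F = F := ext_inner_right ℂ h3
  rw [leftTranslation_toLp] at h7
  have h8 := DFunLike.congr_fun (ContinuousMap.toLp_injective (𝕜 := ℂ) (p := 2) μ h7) 1
  apply hfg
  simpa using h8

/-- A complex representation of `G` is continuous if its matrix coefficients are. -/
def IsContinuousRep {G : Type u} [Monoid G] [TopologicalSpace G] {V : Type v} [AddCommGroup V]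
    [Module ℂ V] (ρ : Representation ℂ G V) : Prop :=
  ∀ (v : V) (f : Module.Dual ℂ V), Continuous fun g => f (ρ g v)

/-! ### Haar averaging, complete reducibility and Stone–Weierstrass -/

section Averaging

set_option linter.unusedSectionVars false

open MeasureTheory

variable {G : Type u} [Group G] [TopologicalSpace G] [IsTopologicalGroup G] [CompactSpace G]
variable {V : Type v} [AddCommGroup V] [Module ℂ V] [FiniteDimensional ℂ V]
variable {ρ : Representation ℂ G V}

lemma integrable_of_continuous [MeasurableSpace G] [BorelSpace G] (μ : Measure G)
    [IsFiniteMeasureOnCompacts μ] {f : G → ℂ} (hf : Continuous f) : Integrable f μ :=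
  hf.integrable_of_hasCompactSupport (HasCompactSupport.of_compactSpace _)

/-- Averaging the rank one map `f ⊗ v` over the group yields an intertwiner. -/
lemma exists_intertwiner_average [MeasurableSpace G] [BorelSpace G] (μ : Measure G)
    [IsFiniteMeasureOnCompacts μ] [μ.IsMulLeftInvariant] {X : Type*} [AddCommGroup X] [Module ℂ X]
    {σ : Representation ℂ G X} (hσ : IsContinuousRep σ) (hρ : IsContinuousRep ρ)
    (f : Module.Dual ℂ X) (v : V) :
    ∃ S : X →ₗ[ℂ] V, (∀ g x, S (σ g x) = ρ g (S x)) ∧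
      ∀ x (φ : Module.Dual ℂ V), φ (S x) = ∫ g, f (σ g⁻¹ x) * φ (ρ g v) ∂μ := by
  let b := Module.finBasis ℂ V
  have hc : ∀ x (φ : Module.Dual ℂ V), Continuous fun g => f (σ g⁻¹ x) * φ (ρ g v) :=
    fun x φ => ((hσ x f).comp continuous_inv).mul (hρ v φ)
  have hint := fun x φ => integrable_of_continuous μ (hc x φ)
  -- This is `x ↦ ∫ f (σ g⁻¹ x) • ρ g v`, written in coordinates so that only scalar functions are
  -- integrated.
  let S : X →ₗ[ℂ] V :=
    { toFun := fun x => ∑ i, (∫ g, f (σ g⁻¹ x) * b.coord i (ρ g v) ∂μ) • b i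
      map_add' := fun x y => by
        rw [← Finset.sum_add_distrib]
        refine Finset.sum_congr rfl fun i _ => ?_
        rw [← add_smul, ← integral_add (hint _ _) (hint _ _)]
        simp only [map_add, add_mul]
      map_smul' := fun c x => by
        rw [RingHom.id_apply, Finset.smul_sum]
        refine Finset.sum_congr rfl fun i _ => ?_
        rw [smul_smul, ← integral_const_mul]
        simp only [map_smul, smul_eq_mul, mul_assoc] }
  have hS : ∀ x (φ : Module.Dual ℂ V), φ (S x) = ∫ g, f (σ g⁻¹ x) * φ (ρ g v) ∂μ := by
    intro x φ
    change φ (∑ i, (∫ g, f (σ g⁻¹ x) * b.coord i (ρ g v) ∂μ) • b i) = _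
    simp only [map_sum, map_smul, smul_eq_mul, ← integral_mul_const]
    rw [← integral_finsetSum _ fun i _ => (hint x (b.coord i)).mul_const _]
    refine integral_congr_ae (ae_of_all _ fun g => ?_)
    change _ = f (σ g⁻¹ x) * φ (ρ g v)
    conv_rhs => rw [← b.sum_repr (ρ g v)]
    simp only [map_sum, map_smul, smul_eq_mul, Finset.mul_sum, mul_assoc, Module.Basis.coord_apply]
  refine ⟨S, fun h x => ?_, hS⟩
  refine (Module.forall_dual_apply_eq_zero_iff ℂ (S (σ h x) - ρ h (S x))).1 (fun φ => ?_) |>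
    sub_eq_zero.1
  have h1 : φ (ρ h (S x)) = ∫ g, f (σ g⁻¹ x) * φ (ρ h (ρ g v)) ∂μ := hS x (φ ∘ₗ ρ h)
  rw [map_sub, sub_eq_zero, hS, h1, ← integral_mul_left_eq_self _ h]
  refine integral_congr_ae (ae_of_all _ fun g => ?_)
  simp only [mul_inv_rev, map_mul, Module.End.mul_apply]
  rw [← Module.End.mul_apply (σ h⁻¹), ← map_mul, inv_mul_cancel, map_one, Module.End.one_apply]

/-- A continuous representation of a compact group on a finite-dimensional space has an invariant
inner product. -/
lemma exists_invariant_inner (hρ : IsContinuousRep ρ) :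
    ∃ c : InnerProductSpace.Core ℂ V, ∀ g x y, c.inner (ρ g x) (ρ g y) = c.inner x y := by
  borelize G
  let μ : Measure G := Measure.haar
  let b := Module.finBasis ℂ V
  let B : V → V → G → ℂ := fun x y g => ∑ i, star (b.coord i (ρ g⁻¹ x)) * b.coord i (ρ g⁻¹ y)
  have hcoord : ∀ i x, Continuous fun g => b.coord i (ρ g⁻¹ x) :=
    fun i x => (hρ x (b.coord i)).comp continuous_inv
  have hB : ∀ x y, Continuous (B x y) := fun x y =>
    continuous_finsetSum _ fun i _ => (continuous_star.comp (hcoord i x)).mul (hcoord i y)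
  have hint := fun x y => integrable_of_continuous μ (hB x y)
  have hdiag : ∀ x g, B x x g = ((∑ i, ‖b.coord i (ρ g⁻¹ x)‖ ^ 2 : ℝ) : ℂ) := by
    intro x g
    push_cast
    exact Finset.sum_congr rfl fun i _ => Complex.conj_mul' _
  have hdiag' : ∀ x, ∫ g, B x x g ∂μ = ((∫ g, ∑ i, ‖b.coord i (ρ g⁻¹ x)‖ ^ 2 ∂μ : ℝ) : ℂ) := by
    intro x
    refine Eq.trans ?_ (integral_ofReal (𝕜 := ℂ))
    exact integral_congr_ae (ae_of_all _ fun g => hdiag x g)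
  refine ⟨{ inner := fun x y => ∫ g, B x y g ∂μ
            conj_inner_symm := fun x y => ?_
            re_inner_nonneg := fun x => ?_
            add_left := fun x y z => ?_
            smul_left := fun x y r => ?_
            definite := fun x hx => ?_ }, fun h x y => ?_⟩
  · rw [← integral_conj]
    refine integral_congr_ae (ae_of_all _ fun g => ?_)
    simp only [B, map_sum, map_mul]
    refine Finset.sum_congr rfl fun i _ => ?_
    rw [mul_comm]
    congr 1
    exact star_star _
  · rw [hdiag']
    exact integral_nonneg fun g => Finset.sum_nonneg fun i _ => by positivity
  · rw [← integral_add (hint _ _) (hint _ _)]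
    simp only [B, map_add, star_add, add_mul, Finset.sum_add_distrib]
  · rw [← integral_const_mul]
    simp only [B, map_smul, smul_eq_mul, star_mul', Finset.mul_sum, mul_assoc]
    rfl
  · change ∫ g, B x x g ∂μ = 0 at hx
    rw [hdiag', Complex.ofReal_eq_zero] at hx
    have hcont : Continuous fun g => ∑ i, ‖b.coord i (ρ g⁻¹ x)‖ ^ 2 :=
      continuous_finsetSum _ fun i _ => (hcoord i x).norm.pow 2
    rw [integral_eq_zero_iff_of_nonneg (fun g => Finset.sum_nonneg fun i _ => by positivity)
      (hcont.integrable_of_hasCompactSupport (HasCompactSupport.of_compactSpace _))] at hx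
    have h0 : ∑ i, ‖b.coord i (ρ 1⁻¹ x)‖ ^ 2 = 0 :=
      congrFun (hcont.ae_eq_iff_eq μ continuous_const |>.1 hx) 1
    simp only [inv_one, map_one, Module.End.one_apply] at h0
    rw [Finset.sum_eq_zero_iff_of_nonneg (fun i _ => by positivity)] at h0
    refine b.ext_elem fun i => ?_
    simpa using h0 i (Finset.mem_univ i)
  · change ∫ g, B (ρ h x) (ρ h y) g ∂μ = ∫ g, B x y g ∂μ
    rw [← integral_mul_left_eq_self _ h]
    refine integral_congr_ae (ae_of_all _ fun g => ?_)
    simp only [B, mul_inv_rev, map_mul, Module.End.mul_apply]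
    simp only [← Module.End.mul_apply (ρ h⁻¹), ← map_mul, inv_mul_cancel, map_one,
      Module.End.one_apply]

/-- The conjugate of a matrix coefficient is a matrix coefficient of the contragredient. -/
lemma exists_star_coefficient_eq (hρ : IsContinuousRep ρ) (f : Module.Dual ℂ V) (v : V) :
    ∃ (φ : Module.Dual ℂ V) (w : V), ∀ g, star (f (ρ g v)) = φ (ρ g⁻¹ w) := by
  obtain ⟨c, hc⟩ := exists_invariant_inner hρ
  let := c.toNormedAddCommGroup
  let := InnerProductSpace.ofCore c.toCore
  have : CompleteSpace V := FiniteDimensional.complete ℂ V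
  have hc' : ∀ g x y, inner ℂ (ρ g x) (ρ g y) = inner ℂ x y := hc
  obtain ⟨w, hw⟩ := (InnerProductSpace.toDual ℂ V).surjective (LinearMap.toContinuousLinearMap f)
  refine ⟨(innerSL ℂ v).toLinearMap, w, fun g => ?_⟩
  have h1 : f (ρ g v) = inner ℂ w (ρ g v) := by
    rw [← InnerProductSpace.toDual_apply_apply, hw]
    rfl
  change _ = inner ℂ v (ρ g⁻¹ w)
  rw [h1, ← hc' g v, ← Module.End.mul_apply, ← map_mul, mul_inv_cancel, map_one,
    Module.End.one_apply]
  exact inner_conj_symm _ _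

/-- The orthogonal complement for an invariant inner product is invariant. -/
lemma exists_isCompl_invariant (hρ : IsContinuousRep ρ) (W : Submodule ℂ V)
    (hW : ∀ g, ∀ w ∈ W, ρ g w ∈ W) :
    ∃ W' : Submodule ℂ V, (∀ g, ∀ w ∈ W', ρ g w ∈ W') ∧ IsCompl W W' := by
  obtain ⟨c, hc⟩ := exists_invariant_inner hρ
  let := c.toNormedAddCommGroup
  let := InnerProductSpace.ofCore c.toCore
  have hc' : ∀ g x y, inner ℂ (ρ g x) (ρ g y) = inner ℂ x y := hc
  refine ⟨Wᗮ, fun g w hw => ?_, Submodule.isCompl_orthogonal W⟩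
  rw [Submodule.mem_orthogonal] at hw ⊢
  intro x hx
  rw [← hc' g⁻¹, ← Module.End.mul_apply _ (ρ g), ← map_mul, inv_mul_cancel, map_one,
    Module.End.one_apply]
  exact hw _ (hW _ _ hx)

/-- An element that acts nontrivially on a representation acts nontrivially on an irreducible
subrepresentation. -/
lemma exists_irreducible_invariant_ne (hρ : IsContinuousRep ρ) (g : G) (hg : ρ g ≠ 1) :
    ∃ W : Submodule ℂ V, (∀ h, ∀ w ∈ W, ρ h w ∈ W) ∧ (∃ w ∈ W, ρ g w ≠ w) ∧
      ∀ W' ≤ W, (∀ h, ∀ w ∈ W', ρ h w ∈ W') → W' = ⊥ ∨ W' = W := by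
  let 𝒮 : Set (Submodule ℂ V) := {W | (∀ h, ∀ w ∈ W, ρ h w ∈ W) ∧ ∃ w ∈ W, ρ g w ≠ w}
  have hne : 𝒮.Nonempty := by
    refine ⟨⊤, fun _ _ _ => Submodule.mem_top, ?_⟩
    by_contra! h
    exact hg (LinearMap.ext fun v => h v Submodule.mem_top)
  -- `W` is minimal among the invariant subspaces on which `g` is nontrivial. If it had a proper
  -- nonzero invariant `W'`, then `g` would be trivial on `W'` and on its complement `C ⊓ W` in `W`,
  -- hence on `W`.
  obtain ⟨W, ⟨hW, hgW⟩, hmin⟩ := wellFounded_lt.has_min 𝒮 hne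
  refine ⟨W, hW, hgW, fun W' hle hW' => ?_⟩
  by_contra! hcon
  obtain ⟨C, hC, hcompl⟩ := exists_isCompl_invariant hρ W' hW'
  have triv : ∀ U < W, (∀ h, ∀ w ∈ U, ρ h w ∈ U) → ∀ w ∈ U, ρ g w = w := by
    intro U hU hinv w hw
    by_contra h
    exact hmin U ⟨hinv, w, hw, h⟩ hU
  have hCW : C ⊓ W < W := by
    refine lt_of_le_of_ne inf_le_right fun h => hcon.1 ?_
    exact hcompl.disjoint.eq_bot_of_le (hle.trans (inf_eq_right.1 h))
  have hsup : W' ⊔ C ⊓ W = W := by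
    rw [← sup_inf_assoc_of_le _ hle, hcompl.sup_eq_top, top_inf_eq]
  obtain ⟨w, hw, hgw⟩ := hgW
  rw [← hsup, Submodule.mem_sup] at hw
  obtain ⟨y, hy, z, hz, rfl⟩ := hw
  apply hgw
  rw [map_add, triv W' (lt_of_le_of_ne hle hcon.2) hW' y hy,
    triv (C ⊓ W) hCW (fun h w hw => ⟨hC h w hw.1, hW h w hw.2⟩) z hz]

/-- A continuous function orthogonal to a point-separating star subalgebra of functions on a
quotient vanishes, if it comes from that quotient. -/
lemma eq_zero_of_integral_mul_eq_zero [MeasurableSpace G] [BorelSpace G] (μ : Measure G)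
    [IsFiniteMeasureOnCompacts μ] [μ.IsOpenPosMeasure] {Q : Type*} [TopologicalSpace Q]
    [CompactSpace Q] (π : C(G, Q)) (A : StarSubalgebra ℂ C(Q, ℂ)) (hA : A.SeparatesPoints)
    (k : C(Q, ℂ)) (hk : ∀ a ∈ A, ∫ g, k (π g) * a (π g) ∂μ = 0) (g : G) : k (π g) = 0 := by
  have hint : ∀ a : C(Q, ℂ), Integrable (fun g => k (π g) * a (π g)) μ := fun a =>
    integrable_of_continuous μ (by fun_prop)
  let Φ : C(Q, ℂ) →L[ℂ] ℂ := LinearMap.mkContinuous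
    { toFun := fun a => ∫ g, k (π g) * a (π g) ∂μ
      map_add' := fun a b => by
        rw [← integral_add (hint _) (hint _)]
        simp only [ContinuousMap.add_apply, mul_add]
      map_smul' := fun c a => by
        rw [RingHom.id_apply, smul_eq_mul, ← integral_const_mul]
        simp only [ContinuousMap.smul_apply, smul_eq_mul, mul_left_comm] }
    (‖k‖ * μ.real Set.univ) (fun a => by
      refine (norm_integral_le_of_norm_le_const (C := ‖k‖ * ‖a‖) (ae_of_all _ fun g => ?_)).trans_eq
        (by ring)
      rw [norm_mul]
      exact mul_le_mul (k.norm_coe_le_norm _) (a.norm_coe_le_norm _) (norm_nonneg _)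
        (norm_nonneg _))
  have hdense := ContinuousMap.starSubalgebra_topologicalClosure_eq_top_of_separatesPoints A hA
  -- By density the functional `Φ` also vanishes at `star k`, where its value is the integral of
  -- `‖k‖ ^ 2` along `π`.
  have hmem : star k ∈ closure (A : Set C(Q, ℂ)) := by
    rw [← StarSubalgebra.topologicalClosure_coe, hdense]
    trivial
  have h0 : Φ (star k) = 0 := by
    have hcl : IsClosed {a | Φ a = 0} := isClosed_eq Φ.continuous continuous_const
    exact closure_minimal (fun a ha => hk a ha) hcl hmem
  have h1 : Φ (star k) = ((∫ g, ‖k (π g)‖ ^ 2 ∂μ : ℝ) : ℂ) := by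
    refine Eq.trans ?_ (integral_ofReal (𝕜 := ℂ))
    refine integral_congr_ae (ae_of_all _ fun g => ?_)
    simpa using Complex.mul_conj' (k (π g))
  rw [h1, Complex.ofReal_eq_zero] at h0
  have hcont : Continuous fun g => ‖k (π g)‖ ^ 2 := by fun_prop
  rw [integral_eq_zero_iff_of_nonneg (fun g => by positivity)
    (hcont.integrable_of_hasCompactSupport (HasCompactSupport.of_compactSpace _))] at h0
  have h2 : ‖k (π g)‖ ^ 2 = 0 := congrFun (hcont.ae_eq_iff_eq μ continuous_const |>.1 h0) g
  simpa using h2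

end Averaging

/-! ### Morphisms, subobjects and direct sums in `Rep G` -/

section RepCatBasic

open Limits

variable {G : Type u} [Group G] [TopologicalSpace G]

/-- The object of `Rep G` given by a continuous representation. -/
def ofRep {V : Type} [AddCommGroup V] [Module ℂ V] [FiniteDimensional ℂ V]
    (ρ : Representation ℂ G V) (hρ : IsContinuousRep ρ) : RepCat G :=
  ⟨FDRep.of ρ, hρ⟩

/-- The linear map underlying a morphism of `Rep G`. -/
def lin {X Y : RepCat G} (f : X ⟶ Y) : X.obj →ₗ[ℂ] Y.obj := f.hom.hom.hom.hom

lemma lin_equivariant {X Y : RepCat G} (f : X ⟶ Y) (g : G) (x : X.obj) :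
    lin f (X.obj.ρ g x) = Y.obj.ρ g (lin f x) :=
  congrArg (fun k => k.hom.hom x) (f.hom.comm g)

/-- An intertwining linear map as a morphism of `Rep G`. -/
def mkHom (X Y : RepCat G) (l : X.obj →ₗ[ℂ] Y.obj)
    (hl : ∀ g x, l (X.obj.ρ g x) = Y.obj.ρ g (l x)) : X ⟶ Y :=
  ObjectProperty.homMk ⟨ObjectProperty.homMk (ModuleCat.ofHom l), fun g => by
    apply FGModuleCat.hom_ext
    ext x
    exact hl g x⟩

@[simp] lemma lin_mkHom (X Y : RepCat G) (l : X.obj →ₗ[ℂ] Y.obj) (hl) :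
    lin (mkHom X Y l hl) = l := rfl

lemma lin_injective {X Y : RepCat G} {f g : X ⟶ Y} (h : lin f = lin g) : f = g := by
  apply ObjectProperty.hom_ext
  apply Action.Hom.ext
  apply FGModuleCat.hom_ext
  exact h

lemma mono_of_injective {X Y : RepCat G} (f : X ⟶ Y) (hf : Function.Injective (lin f)) :
    Mono f := by
  refine ⟨fun g h hgh => lin_injective (LinearMap.ext fun x => hf ?_)⟩
  exact DFunLike.congr_fun (congrArg lin hgh) x

lemma isIso_of_bijective {X Y : RepCat G} (f : X ⟶ Y) (hf : Function.Bijective (lin f)) :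
    IsIso f := by
  let e := LinearEquiv.ofBijective (lin f) hf
  refine ⟨mkHom Y X e.symm.toLinearMap fun g y => ?_, lin_injective ?_, lin_injective ?_⟩
  · apply e.injective
    change e (e.symm _) = lin f (X.obj.ρ g (e.symm y))
    rw [e.apply_symm_apply, lin_equivariant]
    exact congrArg _ (e.apply_symm_apply y).symm
  · ext x
    exact e.symm_apply_apply x
  · ext x
    exact e.apply_symm_apply x

/-- The subobject of `V` given by an invariant subspace. -/
def subRep (V : RepCat G) (W : Submodule ℂ V.obj) (hW : ∀ g, ∀ w ∈ W, V.obj.ρ g w ∈ W) :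
    RepCat G :=
  ofRep (V := W)
    { toFun := fun g => (V.obj.ρ g).restrict (hW g)
      map_one' := by ext; simp
      map_mul' := fun g h => by ext; simp }
    (fun w f => by
      obtain ⟨f', hf'⟩ := f.exists_extend
      refine (V.property w.1 f').congr fun g => ?_
      exact DFunLike.congr_fun hf' ((V.obj.ρ g).restrict (hW g) w))

/-- The inclusion of an invariant subspace. -/
def subRepι (V : RepCat G) (W : Submodule ℂ V.obj) (hW) : subRep V W hW ⟶ V :=
  mkHom _ _ W.subtype fun _ _ => rfl

instance (V : RepCat G) (W : Submodule ℂ V.obj) (hW) : Mono (subRepι V W hW) :=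
  mono_of_injective _ W.injective_subtype

/-- The kernel is an invariant subspace, so its inclusion is a morphism killed by `f`, hence zero.
-/
lemma injective_of_mono {X Y : RepCat G} (f : X ⟶ Y) [Mono f] : Function.Injective (lin f) := by
  rw [← LinearMap.ker_eq_bot]
  have hW : ∀ g, ∀ w ∈ LinearMap.ker (lin f), X.obj.ρ g w ∈ LinearMap.ker (lin f) := by
    intro g w hw
    rw [LinearMap.mem_ker] at hw ⊢
    rw [lin_equivariant, hw, map_zero]
  have h : subRepι X _ hW = 0 := by
    rw [← cancel_mono f, zero_comp]
    refine lin_injective (LinearMap.ext fun w => ?_)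
    exact w.2
  rw [eq_bot_iff]
  intro x hx
  exact DFunLike.congr_fun (congrArg lin h) ⟨x, hx⟩

lemma nontrivial_of_simple (Y : RepCat G) [Simple Y] : Nontrivial Y.obj := by
  by_contra h
  rw [not_nontrivial_iff_subsingleton] at h
  exact id_nonzero Y (lin_injective (LinearMap.ext fun x => Subsingleton.elim _ _))

lemma eq_top_of_simple (Y : RepCat G) [Simple Y] (W : Submodule ℂ Y.obj)
    (hW : ∀ g, ∀ w ∈ W, Y.obj.ρ g w ∈ W) (hne : W ≠ ⊥) : W = ⊤ := by
  have h0 : subRepι Y W hW ≠ 0 := by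
    intro h
    apply hne
    rw [eq_bot_iff]
    intro x hx
    exact DFunLike.congr_fun (congrArg lin h) ⟨x, hx⟩
  have := isIso_of_mono_of_nonzero h0
  rw [eq_top_iff]
  intro y _
  have h1 : lin (subRepι Y W hW) (lin (inv (subRepι Y W hW)) y) = y :=
    DFunLike.congr_fun (congrArg lin (IsIso.inv_hom_id (subRepι Y W hW))) y
  rw [← h1]
  exact Subtype.property (p := (· ∈ W)) _

lemma simple_subRep (V : RepCat G) (W : Submodule ℂ V.obj) (hW : ∀ g, ∀ w ∈ W, V.obj.ρ g w ∈ W)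
    (hne : W ≠ ⊥)
    (hirr : ∀ W' ≤ W, (∀ h, ∀ w ∈ W', V.obj.ρ h w ∈ W') → W' = ⊥ ∨ W' = W) :
    Simple (subRep V W hW) where
  mono_isIso_iff_nonzero {Z} f _ := by
    constructor
    · rintro hf rfl
      apply hne
      rw [eq_bot_iff]
      intro w hw
      have h := DFunLike.congr_fun
        (congrArg lin (IsIso.inv_hom_id (0 : Z ⟶ subRep V W hW))) (⟨w, hw⟩ : W)
      exact (congrArg Subtype.val h).symm
    · intro hf
      refine isIso_of_bijective f ⟨injective_of_mono f, ?_⟩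
      let l : Z.obj →ₗ[ℂ] V.obj := W.subtype ∘ₗ lin f
      have hl : ∀ g x, l (Z.obj.ρ g x) = V.obj.ρ g (l x) := lin_equivariant (f ≫ subRepι V W hW)
      have hle : LinearMap.range l ≤ W := by
        rintro _ ⟨x, rfl⟩
        exact Subtype.property (p := (· ∈ W)) (lin f x)
      rcases hirr (LinearMap.range l) hle (by
        rintro g _ ⟨x, rfl⟩
        exact ⟨_, hl g x⟩) with h | h
      · refine absurd (lin_injective (LinearMap.ext fun x => Subtype.ext (p := (· ∈ W)) ?_)) hf
        exact (Submodule.mem_bot ℂ).1 (h ▸ LinearMap.mem_range_self l x)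
      · intro w
        have hw : w.1 ∈ LinearMap.range l := by
          rw [h]
          exact Subtype.property (p := (· ∈ W)) w
        obtain ⟨x, hx⟩ := hw
        exact ⟨x, Subtype.ext (p := (· ∈ W)) hx⟩

/-- The direct sum of two representations. -/
def prodRep (X Y : RepCat G) : RepCat G :=
  ofRep (V := X.obj × Y.obj)
    { toFun := fun g => (X.obj.ρ g).prodMap (Y.obj.ρ g)
      map_one' := by ext <;> simp
      map_mul' := fun g h => by ext <;> simp }
    (fun v f => by
      refine ((X.property v.1 (f ∘ₗ LinearMap.inl ℂ _ _)).add
        (Y.property v.2 (f ∘ₗ LinearMap.inr ℂ _ _))).congr fun g => ?_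
      change f (X.obj.ρ g v.1, 0) + f (0, Y.obj.ρ g v.2) = f (X.obj.ρ g v.1, Y.obj.ρ g v.2)
      rw [← map_add]
      simp)

lemma prodRep_ρ_apply (X Y : RepCat G) (g : G) (v : X.obj × Y.obj) :
    ((prodRep X Y).obj.ρ g v : X.obj × Y.obj) = (X.obj.ρ g v.1, Y.obj.ρ g v.2) := rfl

/-- The projections from the direct sum of two representations. -/
def prodFan (X Y : RepCat G) : BinaryFan X Y :=
  BinaryFan.mk (P := prodRep X Y) (mkHom _ _ (LinearMap.fst ℂ X.obj Y.obj) fun _ _ => rfl)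
    (mkHom _ _ (LinearMap.snd ℂ X.obj Y.obj) fun _ _ => rfl)

/-- The map into a direct sum with given components. -/
def prodLift {T X Y : RepCat G} (f : T ⟶ X) (g : T ⟶ Y) : T ⟶ prodRep X Y :=
  mkHom T (prodRep X Y) ((lin f).prod (lin g)) fun h x =>
    Prod.ext (lin_equivariant f h x) (lin_equivariant g h x)

/-- The direct sum of two representations is their product. -/
def prodFanIsLimit (X Y : RepCat G) : IsLimit (prodFan X Y) :=
  BinaryFan.IsLimit.mk _ prodLift (fun _ _ => rfl) (fun _ _ => rfl) fun f g m h1 h2 => by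
    refine lin_injective (LinearMap.ext fun x => Prod.ext ?_ ?_)
    · exact DFunLike.congr_fun (congrArg lin h1) x
    · exact DFunLike.congr_fun (congrArg lin h2) x

lemma tensor_ρ_tmul' (X Y : RepCat G) (g : G) (x : X.obj) (y : Y.obj) :
    (X ⊗ Y).obj.ρ g (x ⊗ₜ[ℂ] y : TensorProduct ℂ X.obj Y.obj) =
      (X.obj.ρ g x ⊗ₜ[ℂ] Y.obj.ρ g y : TensorProduct ℂ X.obj Y.obj) := rfl

lemma tensor_ρ_eq_one_iff (X Y : RepCat G) (g : G) :
    (X ⊗ Y).obj.ρ g = 1 ↔ ∀ (x : X.obj) (y : Y.obj),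
      (X.obj.ρ g x ⊗ₜ[ℂ] Y.obj.ρ g y : TensorProduct ℂ X.obj Y.obj) = x ⊗ₜ[ℂ] y := by
  constructor
  · intro h x y
    exact DFunLike.congr_fun h (x ⊗ₜ[ℂ] y : TensorProduct ℂ X.obj Y.obj)
  · intro h
    exact TensorProduct.ext' (M := X.obj) (N := Y.obj) h

lemma dualRep_ρ_apply [IsTopologicalGroup G] (X : RepCat G) (g : G) (φ : Module.Dual ℂ X.obj)
    (x : X.obj) :
    DFunLike.coe (F := Module.Dual ℂ X.obj) ((dualRep X).obj.ρ g φ) x = φ (X.obj.ρ g⁻¹ x) :=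
  dual_ρ_apply X.obj g φ x

end RepCatBasic

/-! ### The generated fusion subcategory -/

section GeneratedSubcategory

set_option linter.unusedSectionVars false

variable {C : Type u} [Category.{v} C] [MonoidalCategory C] [Preadditive C] [RigidCategory C]

lemma generatedFusionSubcategory_iff (S : ObjectProperty C) (X : C) :
    generatedFusionSubcategory S X ↔ ∀ P, IsFusionSubcategory P → S ≤ P → P X := by
  simp only [generatedFusionSubcategory, sInf_apply, iInf_Prop_eq, Subtype.forall,
    Set.mem_ofPred_eq, and_imp]

lemma generatedFusionSubcategory_le {S P : ObjectProperty C} (hP : IsFusionSubcategory P)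
    (hS : S ≤ P) : generatedFusionSubcategory S ≤ P :=
  fun X hX => (generatedFusionSubcategory_iff S X).1 hX P hP hS

lemma le_generatedFusionSubcategory (S : ObjectProperty C) : S ≤ generatedFusionSubcategory S :=
  fun X hX => (generatedFusionSubcategory_iff S X).2 fun _ _ hS => hS X hX

lemma isFusionSubcategory_generated (S : ObjectProperty C) :
    IsFusionSubcategory (generatedFusionSubcategory S) where
  replete := ⟨fun e hX => (generatedFusionSubcategory_iff S _).2 fun P hP hS =>
    hP.replete.of_iso e (generatedFusionSubcategory_le hP hS _ hX)⟩
  monoidal := inferInstance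
  directSums := ⟨fun J _ => ⟨fun X ⟨hX⟩ => (generatedFusionSubcategory_iff S X).2 fun P hP hS => by
    have := hP.directSums
    exact P.prop_of_isLimit hX.isLimit fun j =>
      generatedFusionSubcategory_le hP hS _ (hX.prop_diag_obj j)⟩⟩
  subobjects := ⟨fun f _ hY => (generatedFusionSubcategory_iff S _).2 fun P hP hS =>
    hP.subobjects.prop_of_mono f (generatedFusionSubcategory_le hP hS _ hY)⟩
  rightDuals X hX := (generatedFusionSubcategory_iff S _).2 fun P hP hS =>
    hP.rightDuals X (generatedFusionSubcategory_le hP hS _ hX)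
  leftDuals X hX := (generatedFusionSubcategory_iff S _).2 fun P hP hS =>
    hP.leftDuals X (generatedFusionSubcategory_le hP hS _ hX)

end GeneratedSubcategory

/-! ### The action of the centre; the inclusion of `C₀` in `C_Z` -/

section Center

variable {G : Type u} [Group G] [TopologicalSpace G]

/-- A central element as an endomorphism of a representation. -/
def centralEnd (X : RepCat G) {z : G} (hz : z ∈ Subgroup.center G) : X ⟶ X :=
  mkHom X X (X.obj.ρ z) fun g x => by
    rw [← Module.End.mul_apply, ← Module.End.mul_apply, ← map_mul, ← map_mul,
      Subgroup.mem_center_iff.1 hz g]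

/-- Central elements act as natural endomorphisms of the identity functor, so their triviality can
be tested after a monomorphism or on the projections of a product. -/
lemma centralEnd_naturality {X Y : RepCat G} (f : X ⟶ Y) {z : G} (hz : z ∈ Subgroup.center G) :
    centralEnd X hz ≫ f = f ≫ centralEnd Y hz :=
  lin_injective (LinearMap.ext fun x => lin_equivariant f z x)

lemma centralEnd_eq_id_iff (X : RepCat G) {z : G} (hz : z ∈ Subgroup.center G) :
    centralEnd X hz = 𝟙 X ↔ X.obj.ρ z = 1 :=
  ⟨fun h => congrArg lin h, fun h => lin_injective h⟩

lemma dualRep_ρ_eq_one [IsTopologicalGroup G] (X : RepCat G) (g : G) (h : X.obj.ρ g = 1) :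
    (dualRep X).obj.ρ g = 1 := by
  have h' : X.obj.ρ g⁻¹ = 1 := by
    rw [← mul_one (X.obj.ρ g⁻¹), ← h, ← map_mul, inv_mul_cancel, map_one, h]
  refine LinearMap.ext fun φ => LinearMap.ext (M := X.obj) fun x => ?_
  refine (dualRep_ρ_apply X g φ x).trans ?_
  rw [h']
  rfl

lemma isFusionSubcategory_trivialOnCenter [IsTopologicalGroup G] :
    IsFusionSubcategory (trivialOnCenter G) := by
  have hmono : ∀ {X Y : RepCat G} (f : X ⟶ Y) [Mono f], trivialOnCenter G Y →
      trivialOnCenter G X := by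
    intro X Y f _ hY z hz
    rw [← centralEnd_eq_id_iff X hz, ← cancel_mono f, centralEnd_naturality,
      (centralEnd_eq_id_iff Y hz).2 (hY z hz), Category.comp_id, Category.id_comp]
  exact {
    replete := ⟨fun e hX => hmono e.inv hX⟩
    monoidal :=
      { prop_unit := fun z _ => LinearMap.ext fun x => rfl
        prop_tensor := fun X Y hX hY z hz => by
          rw [tensor_ρ_eq_one_iff]
          intro x y
          rw [hX z hz, hY z hz]
          rfl }
    directSums := ⟨fun J _ => ⟨fun X ⟨hX⟩ z hz => by
      rw [← centralEnd_eq_id_iff X hz]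
      refine hX.isLimit.hom_ext fun j => ?_
      refine (centralEnd_naturality _ hz).trans ?_
      rw [(centralEnd_eq_id_iff _ hz).2 (hX.prop_diag_obj j z hz), Category.comp_id,
        Category.id_comp]⟩⟩
    subobjects := ⟨hmono⟩
    rightDuals := fun X hX z hz => dualRep_ρ_eq_one X z (hX z hz)
    -- The left dual is again the contragredient, as the left rigid structure comes from the right
    -- one by the braiding.
    leftDuals := fun X hX z hz => dualRep_ρ_eq_one X z (hX z hz) }

/-- **Schur's lemma** for central elements. -/
lemma exists_ρ_eq_smul_of_simple (Y : RepCat G) [Simple Y] {z : G}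
    (hz : z ∈ Subgroup.center G) : ∃ c : ℂ, ∀ y, Y.obj.ρ z y = c • y := by
  have := nontrivial_of_simple Y
  obtain ⟨c, hc⟩ := Module.End.exists_eigenvalue (Y.obj.ρ z)
  refine ⟨c, fun y => ?_⟩
  have htop := eq_top_of_simple Y (Module.End.eigenspace (Y.obj.ρ z) c) (fun g w hw => by
    rw [Module.End.mem_eigenspace_iff] at hw ⊢
    rw [← map_smul, ← hw]
    exact (lin_equivariant (centralEnd Y hz) g w)) hc
  exact Module.End.mem_eigenspace_iff.1 (htop ▸ Submodule.mem_top (x := y))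

/-- The scalar by which `g` acts on `Y` is undone by its contragredient action on the dual. -/
lemma tensor_dualRep_ρ_eq_one [IsTopologicalGroup G] (Y : RepCat G) (g : G) (c : ℂ)
    (h : ∀ y, Y.obj.ρ g y = c • y) : (Y ⊗ dualRep Y).obj.ρ g = 1 := by
  rw [tensor_ρ_eq_one_iff]
  intro y φ
  let φ' : Module.Dual ℂ Y.obj := φ
  have h1 : c • (dualRep Y).obj.ρ g φ = φ := by
    refine LinearMap.ext (M := Y.obj) fun x => ?_
    refine (congrArg (c * ·) (dualRep_ρ_apply Y g φ x)).trans ?_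
    change c * φ' (Y.obj.ρ g⁻¹ x) = φ' x
    rw [← smul_eq_mul, ← map_smul, ← map_smul, ← h, ← Module.End.mul_apply, ← map_mul,
      inv_mul_cancel, map_one, Module.End.one_apply]
  rw [h, TensorProduct.smul_tmul, h1]

lemma exists_smul_of_tensor_dualRep_ρ_eq_one [IsTopologicalGroup G] (Y : RepCat G) (g : G)
    (h : (Y ⊗ dualRep Y).obj.ρ g = 1) : ∃ c : ℂ, ∀ y, Y.obj.ρ g y = c • y := by
  rw [tensor_ρ_eq_one_iff] at h
  have key : ∀ (y x : Y.obj) (ψ φ : Module.Dual ℂ Y.obj),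
      ψ (Y.obj.ρ g y) * φ x = ψ y * φ (Y.obj.ρ g x) := by
    intro y x ψ φ
    -- Pairing the second factor with `ρ g x` instead of `x` cancels the inverse in the
    -- contragredient action.
    let ev : (dualRep Y).obj →ₗ[ℂ] ℂ := Module.Dual.eval ℂ Y.obj (Y.obj.ρ g x)
    have h1 := congrArg (TensorProduct.lid ℂ ℂ ∘ TensorProduct.map ψ ev) (h y φ)
    simp only [Function.comp_apply, TensorProduct.map_tmul, TensorProduct.lid_tmul,
      smul_eq_mul] at h1
    have h2 : ev ((dualRep Y).obj.ρ g φ) = φ x := by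
      refine (dualRep_ρ_apply Y g φ (Y.obj.ρ g x)).trans ?_
      rw [← Module.End.mul_apply, ← map_mul, inv_mul_cancel, map_one]
      rfl
    rw [h2] at h1
    exact h1
  rcases subsingleton_or_nontrivial Y.obj with hs | hn
  · exact ⟨0, fun y => Subsingleton.elim _ _⟩
  · obtain ⟨y, hy⟩ := exists_ne (0 : Y.obj)
    obtain ⟨ψ, hψ⟩ : ∃ ψ : Module.Dual ℂ Y.obj, ψ y ≠ 0 := by
      by_contra! hcon
      exact hy ((Module.forall_dual_apply_eq_zero_iff ℂ y).1 hcon)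
    -- Dividing `key` by `ψ y ≠ 0`, for fixed `y` and `ψ`, exhibits the scalar.
    refine ⟨ψ (Y.obj.ρ g y) / ψ y, fun x => sub_eq_zero.1 <|
      (Module.forall_dual_apply_eq_zero_iff ℂ _).1 fun φ => ?_⟩
    rw [map_sub, map_smul, smul_eq_mul, div_mul_eq_mul_div, key, mul_div_cancel_left₀ _ hψ,
      sub_self]

lemma adjointSubcategory_le_trivialOnCenter [IsTopologicalGroup G] :
    adjointSubcategory (RepCat G) ≤ trivialOnCenter G := by
  refine generatedFusionSubcategory_le isFusionSubcategory_trivialOnCenter ?_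
  rintro X ⟨-, Y, hY, i, hi⟩
  refine isFusionSubcategory_trivialOnCenter.subobjects.prop_of_mono i fun z hz => ?_
  obtain ⟨c, hc⟩ := exists_ρ_eq_smul_of_simple Y hz
  exact tensor_dualRep_ρ_eq_one Y z c hc

end Center

/-! ### Fusion subcategories are determined by their common kernels -/

section Compact

variable {G : Type u} [Group G] [TopologicalSpace G] [IsTopologicalGroup G] [CompactSpace G]

/-- An element that acts nontrivially on a representation acts nontrivially on a simple
subobject. -/
lemma exists_simple_contained_ρ_ne_one (V : RepCat G) (g : G) (hg : V.obj.ρ g ≠ 1) :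
    ∃ X : RepCat G, Simple X ∧ Contained X V ∧ X.obj.ρ g ≠ 1 := by
  obtain ⟨W, hW, ⟨w, hw, hgw⟩, hirr⟩ := exists_irreducible_invariant_ne V.property g hg
  have hne : W ≠ ⊥ := by
    rintro rfl
    rw [Submodule.mem_bot] at hw
    exact hgw (by rw [hw, map_zero])
  refine ⟨subRep V W hW, simple_subRep V W hW hne hirr, ⟨subRepι V W hW, inferInstance⟩,
    fun h => hgw ?_⟩
  exact congrArg Subtype.val (DFunLike.congr_fun h (⟨w, hw⟩ : W))

lemma exists_simple_ρ_ne_one [T2Space G] (g : G) (hg : g ≠ 1) :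
    ∃ X : RepCat G, Simple X ∧ X.obj.ρ g ≠ 1 := by
  obtain ⟨n, ρ, hρ, hne⟩ := exists_representation_ne_one g hg
  obtain ⟨X, hX, -, h⟩ := exists_simple_contained_ρ_ne_one (ofRep ρ hρ) g hne
  exact ⟨X, hX, h⟩

/-- The elements acting trivially on `C₀` are central. -/
lemma mem_center_of_adjointSubcategory [T2Space G] (n : G)
    (hn : ∀ X, adjointSubcategory (RepCat G) X → X.obj.ρ n = 1) : n ∈ Subgroup.center G := by
  have hscalar : ∀ Y : RepCat G, Simple Y → ∃ c : ℂ, ∀ y, Y.obj.ρ n y = c • y := by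
    intro Y hY
    refine exists_smul_of_tensor_dualRep_ρ_eq_one Y n ?_
    by_contra h
    obtain ⟨X, hX, hXY, hne⟩ := exists_simple_contained_ρ_ne_one _ n h
    exact hne (hn X (le_generatedFusionSubcategory _ X ⟨hX, Y, hY, hXY⟩))
  rw [Subgroup.mem_center_iff]
  intro g
  by_contra hne
  -- This commutator is trivial on every simple `Y`, where `n` is a scalar, contradicting the
  -- separation of points.
  have hcomm : (n * g)⁻¹ * (g * n) ≠ 1 := fun h => hne (inv_mul_eq_one.1 h).symm
  obtain ⟨Y, hY, h⟩ := exists_simple_ρ_ne_one _ hcomm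
  obtain ⟨c, hc⟩ := hscalar Y hY
  apply h
  have h1 : Y.obj.ρ (g * n) = Y.obj.ρ (n * g) := by
    ext y
    simp only [map_mul, Module.End.mul_apply, hc, map_smul]
  rw [map_mul, h1, ← map_mul, inv_mul_cancel, map_one]

/-- The algebra of matrix coefficients of a fusion subcategory `P`, as functions on a space `Q` to
which `G` maps. -/
def coefficientAlgebra {P : ObjectProperty (RepCat G)} (hP : IsFusionSubcategory P) {Q : Type*}
    [TopologicalSpace Q] (π : G → Q) :
    StarSubalgebra ℂ C(Q, ℂ) where
  carrier := {a | ∃ V : RepCat G, P V ∧ ∃ (v : V.obj) (f : Module.Dual ℂ V.obj),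
    ∀ g, a (π g) = f (V.obj.ρ g v)}
  mul_mem' := by
    rintro a b ⟨V, hV, v, f, ha⟩ ⟨W, hW, w, k, hb⟩
    refine ⟨V ⊗ W, hP.monoidal.prop_tensor V W hV hW,
      (v ⊗ₜ[ℂ] w : TensorProduct ℂ V.obj W.obj),
      (TensorProduct.lid ℂ ℂ).toLinearMap ∘ₗ TensorProduct.map f k, fun g => ?_⟩
    rw [tensor_ρ_tmul', ContinuousMap.mul_apply, ha, hb]
    rfl
  add_mem' := by
    rintro a b ⟨V, hV, v, f, ha⟩ ⟨W, hW, w, k, hb⟩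
    have := hP.directSums
    refine ⟨prodRep V W, P.prop_of_isLimit_binaryFan (prodFanIsLimit V W) hV hW,
      ((v, w) : V.obj × W.obj), f.coprod k, fun g => ?_⟩
    rw [prodRep_ρ_apply, ContinuousMap.add_apply, ha, hb]
    rfl
  algebraMap_mem' c :=
    ⟨𝟙_ (RepCat G), hP.monoidal.prop_unit, (1 : ℂ), c • LinearMap.id (M := ℂ), fun g => by
      change c = c * 1
      rw [mul_one]⟩
  star_mem' := by
    rintro a ⟨V, hV, v, f, ha⟩
    obtain ⟨φ, w, h⟩ := exists_star_coefficient_eq V.property f v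
    refine ⟨dualRep V, hP.rightDuals V hV, φ, Module.Dual.eval ℂ V.obj w, fun g => ?_⟩
    rw [ContinuousMap.star_apply, ha, h]
    exact (dualRep_ρ_apply V g φ w).symm

/-- A matrix coefficient of a representation that is trivial on a normal subgroup, as a function on
the quotient. -/
def quotientCoefficient (N : Subgroup G) (V : RepCat G) (hV : ∀ z ∈ N, V.obj.ρ z = 1) (v : V.obj)
    (f : Module.Dual ℂ V.obj) : C(G ⧸ N, ℂ) where
  toFun := Quotient.lift (fun g => f (V.obj.ρ g v)) fun g h hgh => by
    have h1 := hV _ (QuotientGroup.leftRel_apply.1 hgh)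
    have h2 : V.obj.ρ h = V.obj.ρ g := by
      rw [← mul_inv_cancel_left g h, map_mul, h1, mul_one]
    rw [h2]
  continuous_toFun := (V.property v f).quotient_lift _

/-- The homomorphisms to a fusion subcategory separate the points of a representation, if the
elements that are trivial on that subcategory are trivial on the representation. -/
lemma exists_hom_apply_ne_zero {P : ObjectProperty (RepCat G)} (hP : IsFusionSubcategory P)
    (N : Subgroup G) [N.Normal] (hN : ∀ g, g ∈ N ↔ ∀ V, P V → V.obj.ρ g = 1) (X : RepCat G)
    (hX : ∀ g ∈ N, X.obj.ρ g = 1) (k : X.obj) (hk : k ≠ 0) :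
    ∃ (V : RepCat G) (_ : P V) (S : X ⟶ V), lin S k ≠ 0 := by
  by_contra! hcon
  borelize G
  let μ : MeasureTheory.Measure G := MeasureTheory.Measure.haar
  let π : C(G, G ⧸ N) := ⟨QuotientGroup.mk, QuotientGroup.continuous_mk⟩
  let A := coefficientAlgebra hP π
  have hA : A.SeparatesPoints := by
    intro p q hpq
    obtain ⟨g, rfl⟩ := QuotientGroup.mk_surjective p
    obtain ⟨h, rfl⟩ := QuotientGroup.mk_surjective q
    rw [Ne, QuotientGroup.eq, hN] at hpq
    push Not at hpq
    obtain ⟨V, hV, hne⟩ := hpq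
    obtain ⟨v, hv⟩ : ∃ v, V.obj.ρ h v - V.obj.ρ g v ≠ 0 := by
      by_contra! hv
      apply hne
      ext v
      rw [map_mul, Module.End.mul_apply, sub_eq_zero.1 (hv v), ← Module.End.mul_apply, ← map_mul,
        inv_mul_cancel, map_one]
    obtain ⟨f, hf⟩ : ∃ f : Module.Dual ℂ V.obj, f (V.obj.ρ h v - V.obj.ρ g v) ≠ 0 := by
      by_contra! hf
      exact hv ((Module.forall_dual_apply_eq_zero_iff ℂ _).1 hf)
    refine ⟨_, ⟨quotientCoefficient N V (fun z hz => (hN z).1 hz V hV) v f,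
      ⟨V, hV, v, f, fun g => rfl⟩, rfl⟩, fun heq => hf ?_⟩
    rw [map_sub, sub_eq_zero]
    exact heq.symm
  refine hk ((Module.forall_dual_apply_eq_zero_iff ℂ k).1 fun f => ?_)
  have hdual : ∀ z ∈ N, (dualRep X).obj.ρ z = 1 := fun z hz => dualRep_ρ_eq_one X z (hX z hz)
  have hcoeff : ∀ g, quotientCoefficient N (dualRep X) hdual f (Module.Dual.eval ℂ X.obj k) (π g) =
      f (X.obj.ρ g⁻¹ k) := fun g => dualRep_ρ_apply X g f k
  have h0 := eq_zero_of_integral_mul_eq_zero μ π A hA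
    (quotientCoefficient N (dualRep X) hdual f (Module.Dual.eval ℂ X.obj k)) (fun a ha => by
      obtain ⟨V, hV, v, φ, hφ⟩ := ha
      -- The integral to be computed is `φ (S k)` for the averaged intertwiner `S`, and `S k = 0` by
      -- `hcon`.
      obtain ⟨S, hS, hint⟩ := exists_intertwiner_average μ X.property V.property f v
      simp only [hcoeff, hφ]
      rw [← hint]
      have := hcon V hV (mkHom X V S hS)
      rw [lin_mkHom] at this
      rw [this, map_zero]) 1
  rw [hcoeff] at h0
  simpa using h0

/-- A representation belongs to a fusion subcategory if the elements that are trivial on that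
subcategory are trivial on the representation. -/
lemma prop_of_forall_ρ_eq_one {P : ObjectProperty (RepCat G)} (hP : IsFusionSubcategory P)
    (N : Subgroup G) [N.Normal] (hN : ∀ g, g ∈ N ↔ ∀ V, P V → V.obj.ρ g = 1) (X : RepCat G)
    (hX : ∀ g ∈ N, X.obj.ρ g = 1) : P X := by
  let 𝒮 : Set (Submodule ℂ X.obj) := {K | ∃ (V : RepCat G) (_ : P V) (S : X ⟶ V),
    LinearMap.ker (lin S) = K}
  have hne : 𝒮.Nonempty := ⟨_, 𝟙_ (RepCat G), hP.monoidal.prop_unit, 0, rfl⟩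
  -- A morphism to `P` with minimal kernel is injective: pairing it with one that does not kill a
  -- given kernel vector would shrink the kernel.
  obtain ⟨K, ⟨V, hV, S, rfl⟩, hmin⟩ := wellFounded_lt.has_min 𝒮 hne
  have hbot : LinearMap.ker (lin S) = ⊥ := by
    by_contra hK
    obtain ⟨k, hk, hk0⟩ := Submodule.exists_mem_ne_zero_of_ne_bot hK
    obtain ⟨V', hV', S', hS'⟩ := exists_hom_apply_ne_zero hP N hN X hX k hk0
    have := hP.directSums
    refine hmin _ ⟨prodRep V V', P.prop_of_isLimit_binaryFan (prodFanIsLimit V V') hV hV',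
      prodLift S S', rfl⟩ ?_
    change LinearMap.ker ((lin S).prod (lin S')) < _
    rw [LinearMap.ker_prod]
    refine lt_of_le_of_ne inf_le_left fun h => hS' ?_
    rw [← h] at hk
    exact hk.2
  have := mono_of_injective S (LinearMap.ker_eq_bot.1 hbot)
  exact hP.subobjects.prop_of_mono S hV

/-- The common kernel of `C₀` is exactly the centre, so `prop_of_forall_ρ_eq_one` applies with `N`
the centre. -/
theorem adjointSubcategory_eq_trivialOnCenter [T2Space G] :
    adjointSubcategory (RepCat G) = trivialOnCenter G := by
  refine le_antisymm adjointSubcategory_le_trivialOnCenter fun X hX => ?_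
  refine prop_of_forall_ρ_eq_one (isFusionSubcategory_generated _) (Subgroup.center G)
    (fun g => ⟨fun hg V hV => ?_, mem_center_of_adjointSubcategory g⟩) X hX
  exact adjointSubcategory_le_trivialOnCenter V hV g hg

end Compact

/-! ### Lifting braided functors to full subcategories -/

section Lift

open Functor Functor.LaxMonoidal

universe u' v'

variable {C : Type u} [Category.{v} C] [MonoidalCategory C] {D : Type u'} [Category.{v'} D]
  [MonoidalCategory D] (P : ObjectProperty D) [P.IsMonoidal] (F : C ⥤ D) (h : ∀ X, P (F.obj X))

/-- The lift of a monoidal functor to a full monoidal subcategory. -/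
instance monoidalLift [F.Monoidal] : (P.lift F h).Monoidal :=
  Functor.CoreMonoidal.toMonoidal
    { εIso := P.isoMk (Monoidal.εIso F)
      μIso := fun X Y => P.isoMk (Monoidal.μIso F X Y)
      μIso_hom_natural_left := fun f X' => P.hom_ext (μ_natural_left F f X')
      μIso_hom_natural_right := fun X' f => P.hom_ext (μ_natural_right F X' f)
      associativity := fun X Y Z => P.hom_ext (LaxMonoidal.associativity F X Y Z)
      left_unitality := fun X => P.hom_ext (LaxMonoidal.left_unitality F X)
      right_unitality := fun X => P.hom_ext (LaxMonoidal.right_unitality F X) }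

/-- The lift of a braided functor to a full braided subcategory. -/
instance braidedLift [BraidedCategory C] [BraidedCategory D] [F.Braided] :
    (P.lift F h).Braided where
  braided X Y := P.hom_ext (LaxBraided.braided X Y)

end Lift

/-! ### Inflation is braided and fully faithful; its essential image -/

section Inflation

variable (G : Type u) [Group G] [TopologicalSpace G] (N : Subgroup G) [N.Normal]

instance : (inflation G N).Monoidal :=
  Functor.CoreMonoidal.toMonoidal
    { εIso := Iso.refl _
      μIso := fun _ _ => Iso.refl _
      μIso_hom_natural_left := fun _ _ => lin_injective rfl
      μIso_hom_natural_right := fun _ _ => lin_injective rfl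
      associativity := fun X Y Z => lin_injective <|
        TensorProduct.ext_threefold (M := X.obj) (N := Y.obj) (P := Z.obj) fun _ _ _ => rfl
      left_unitality := fun X => lin_injective <|
        TensorProduct.ext' (M := ℂ) (N := X.obj) fun _ _ => rfl
      right_unitality := fun X => lin_injective <|
        TensorProduct.ext' (M := X.obj) (N := ℂ) fun _ _ => rfl }

instance : (inflation G N).Braided where
  braided X Y := lin_injective <|
    TensorProduct.ext' (M := X.obj) (N := Y.obj) fun _ _ => rfl

instance : (inflation G N).Faithful where
  map_injective h := lin_injective (congrArg lin h :)

instance : (inflation G N).Full where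
  map_surjective {X Y} f := by
    let l : X.obj →ₗ[ℂ] Y.obj :=
      lin (X := (inflation G N).obj X) (Y := (inflation G N).obj Y) f
    refine ⟨mkHom X Y l fun q x => ?_, lin_injective (Y := (inflation G N).obj Y) rfl⟩
    obtain ⟨g, rfl⟩ := QuotientGroup.mk_surjective q
    exact lin_equivariant f g x

/-- A representation that is trivial on `N`, as a representation of `G ⧸ N`. -/
def deflation (X : RepCat G) (hX : ∀ g ∈ N, X.obj.ρ g = 1) : RepCat (G ⧸ N) :=
  ofRep (V := X.obj) (QuotientGroup.lift N X.obj.ρ fun g hg => hX g hg) fun v f =>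
    isQuotientMap_quot_mk.continuous_iff.2 (X.property v f)

/-- Inflating a deflated representation gives it back. -/
def inflationDeflationIso (X : RepCat G) (hX : ∀ g ∈ N, X.obj.ρ g = 1) :
    (inflation G N).obj (deflation G N X hX) ≅ X where
  hom := mkHom _ _ LinearMap.id fun _ _ => rfl
  inv := mkHom _ _ LinearMap.id fun _ _ => rfl
  hom_inv_id := lin_injective rfl
  inv_hom_id := lin_injective rfl

end Inflation

end RepCenter

end

theorem mainTheorem2 (G : Type u) [Group G] [TopologicalSpace G] [IsTopologicalGroup G]
    [CompactSpace G] [T2Space G] :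
    RepCenter.adjointSubcategory (RepCenter.RepCat G) = RepCenter.trivialOnCenter G ∧
    ∃ (F : RepCenter.RepCat (G ⧸ Subgroup.center G) ⥤
          (RepCenter.adjointSubcategory (RepCenter.RepCat G)).FullSubcategory) (_ : F.Braided),
      F.IsEquivalence ∧ F.Additive ∧ F.Linear ℂ ∧
      Nonempty (F ⋙ (RepCenter.adjointSubcategory (RepCenter.RepCat G)).ι ≅
        RepCenter.inflation G (Subgroup.center G)) := by
  have heq := RepCenter.adjointSubcategory_eq_trivialOnCenter (G := G)
  have h : ∀ X, RepCenter.adjointSubcategory (RepCenter.RepCat G)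
      ((RepCenter.inflation G (Subgroup.center G)).obj X) := by
    rw [heq]
    intro X z hz
    have h1 : (z : G ⧸ Subgroup.center G) = 1 := (QuotientGroup.eq_one_iff z).2 hz
    change X.obj.ρ (z : G ⧸ Subgroup.center G) = 1
    rw [h1, map_one]
  refine ⟨heq, ObjectProperty.lift _ (RepCenter.inflation G (Subgroup.center G)) h, inferInstance,
    { faithful := inferInstance, full := inferInstance, essSurj := ⟨fun X => ?_⟩ }, ⟨?_⟩, ⟨?_⟩,
    ⟨Iso.refl _⟩⟩
  -- An object of `C₀` is trivial on the centre, so it descends to the quotient and is the inflation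
  -- of its deflation.
  · have hX : RepCenter.trivialOnCenter G X.obj := heq ▸ X.property
    exact ⟨_, ⟨ObjectProperty.isoMk _ (RepCenter.inflationDeflationIso G _ X.obj hX)⟩⟩
  · intro X Y f g
    exact ObjectProperty.hom_ext _ rfl
  · intro X Y f c
    exact ObjectProperty.hom_ext _ rfl
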